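/- For a convex body $K\subset\mathbb{R}^n$ (a convex, compact set with non-empty interior), the John ellipsoid $B_K$ of $K$ is the ellipsoid of maximal volume contained in $K$. There are universal constants $C_0', C_1', C_2>0$ such that for all sufficiently large $n\in\mathbb{N}$ the following hold. (1) There exists a convex body $K\subset\mathbb{R}^n$ such that the center of its John ellipsoid $B_K$ is $0$ and $$\mathrm{vol}\Big(\big(1-C_0'\sqrt{\tfrac{\log n}{n}}\big)\,n\,B_K\cap K\Big)\le \tfrac12\,\mathrm{vol}(K).$$ (2) There exists a polytope $P\subset\mathbb{R}^n$ with non-empty interior and with at most $C_2 n^2$ facets such that the center of its John ellipsoid $B_P$ is $0$ and $$\mathrm{vol}\Big(C_1'\,\tfrac{n}{\log n}\,B_P\cap P\Big)\le \tfrac12\,\mathrm{vol}(P).$$ -/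

import Mathlib

open MeasureTheory Filter
open scoped Pointwise

/-- A convex body in `ℝⁿ`: a convex, compact set with non-empty interior. -/
def IsConvexBody {n : ℕ} (K : Set (EuclideanSpace ℝ (Fin n))) : Prop :=
  Convex ℝ K ∧ IsCompact K ∧ (interior K).Nonempty

/-- `E` is a (solid, non-degenerate) ellipsoid with center `c`: the image of the closed Euclidean
unit ball under an invertible affine map that sends `0` to `c`. -/
def IsEllipsoidCenteredAt {n : ℕ} (c : EuclideanSpace ℝ (Fin n))
    (E : Set (EuclideanSpace ℝ (Fin n))) : Prop :=
  ∃ A : EuclideanSpace ℝ (Fin n) ≃L[ℝ] EuclideanSpace ℝ (Fin n),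
    E = (fun x => c + A x) '' Metric.closedBall 0 1

/-- `E` is an ellipsoid, with some center. -/
def IsEllipsoid {n : ℕ} (E : Set (EuclideanSpace ℝ (Fin n))) : Prop :=
  ∃ c, IsEllipsoidCenteredAt c E

/-- `B` is the John ellipsoid of `K`: an ellipsoid contained in `K` whose volume is maximal among
all ellipsoids contained in `K`. -/
def IsJohnEllipsoid {n : ℕ} (K B : Set (EuclideanSpace ℝ (Fin n))) : Prop :=
  IsEllipsoid B ∧ B ⊆ K ∧ ∀ E, IsEllipsoid E → E ⊆ K → volume E ≤ volume B

/-- A polytope in `ℝⁿ`: a bounded intersection of finitely many closed half-spaces. -/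
def IsPolytope {n : ℕ} (P : Set (EuclideanSpace ℝ (Fin n))) : Prop :=
  Bornology.IsBounded P ∧
    ∃ s : Finset (EuclideanSpace ℝ (Fin n) × ℝ), P = {x | ∀ p ∈ s, inner ℝ p.1 x ≤ p.2}

/-- `F` is a facet of the set `P` in `ℝⁿ`: a non-empty exposed face of dimension `n - 1`, where
the dimension of a non-empty convex set is that of its affine hull. -/
def IsFacet {n : ℕ} (P F : Set (EuclideanSpace ℝ (Fin n))) : Prop :=
  F.Nonempty ∧ IsExposed ℝ P F ∧ Module.finrank ℝ (vectorSpan ℝ F) + 1 = n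

/-!
Both bodies are built inside the same cone over a cube. In `ℝ^(m+1)`, put `n = m + 1`, call the
first coordinate `x₀` the height and the others the tail. The unit vectors `-e₀` and
`(1/n) e₀ ± β e_{j+1}` with `β = √(1 - 1/n²)` carry a John decomposition of the identity
(`isJohnDecomposition_contactPoint`), and the half-spaces of height `1` they define intersect in
the cone with heights from `-1` to `n` and sections `β |x_{j+1}| ≤ 1 - x₀ / n`. By the easy
direction of John's theorem (`IsJohnDecomposition.isJohnEllipsoid`), *every* convex set between
the unit ball and this cone has the unit ball as its John ellipsoid. So the cone may be cut with
any further constraints that keep the ball, and these can be chosen such that the sections grow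
with the height until shortly before the apex, which drives the volume away from the ball.

For the convex body the constraint is `‖tail x‖ ≤ 2 + x₀ / n`. By concentration of measure a ball
of bounded radius in `ℝ^m` has at least half its volume in the cube of half-side `9 √(log n / n)`
(`volume_closedBall_div_two_le`), so the cone does not cut away more than that until height
`n (1 - 9 √(log n / n))`, and up to there the widening of the round sections makes the volume of
low heights negligible (`roundBody_numerics`).

For the polytope the constraints are `|x_{i+1}| + |x_{j+1}| ≤ 3/2 + x₀ / n` for all pairs of tail
coordinates. A section then has at most one coordinate above half of the bound `q` for pairs, so
its volume is at most `2 m q^m` (`volume_pairPolytope_inter_le`), while it contains the cube of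
side `q` as long as the cone does, which holds up to height `n / 6` (`le_volume_pairPolytope`). The
exponential growth of `q^m` beats the factor `m`, so most of the volume even lies at heights
above `n / 16`, hence above `(1/16) n / log n`. The facets are at most as many
as the half-spaces (`finite_facets_and_ncard_le`).
-/

/-! ### John decompositions -/

/-- A *John decomposition of the identity*: unit vectors `u i` with weights `c i ≥ 0` such that
`∑ c i • u i = 0` and `∑ c i ⟪u i, x⟫ ^ 2 = ‖x‖ ^ 2` for every `x`. -/
structure IsJohnDecomposition {n : ℕ} {ι : Type*} [Fintype ι]
    (u : ι → EuclideanSpace ℝ (Fin n)) (c : ι → ℝ) : Prop where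
  nonneg : ∀ i, 0 ≤ c i
  norm_eq_one : ∀ i, ‖u i‖ = 1
  sum_smul : ∑ i, c i • u i = 0
  sum_inner_sq : ∀ x, ∑ i, c i * inner ℝ (u i) x ^ 2 = ‖x‖ ^ 2

namespace IsJohnDecomposition

variable {n : ℕ} {ι : Type*} [Fintype ι] {u : ι → EuclideanSpace ℝ (Fin n)} {c : ι → ℝ}

/-- Taking traces in the decomposition of the identity. -/
theorem sum_weight (h : IsJohnDecomposition u c) : ∑ i, c i = n := by
  let b := EuclideanSpace.basisFun (Fin n) ℝ
  have h1 : ∑ k, ∑ i, c i * inner ℝ (u i) (b k) ^ 2 = n := by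
    simp [h.sum_inner_sq]
  rw [Finset.sum_comm] at h1
  simpa [← Finset.mul_sum, b.sum_sq_inner_left, h.norm_eq_one] using h1

theorem sum_inner (h : IsJohnDecomposition u c) (x : EuclideanSpace ℝ (Fin n)) :
    ∑ i, c i * inner ℝ (u i) x = 0 := by
  have := congrArg (fun y => inner ℝ y x) h.sum_smul
  simpa [_root_.sum_inner, real_inner_smul_left] using this

/-- The intersection of the half-spaces `⟪u i, x⟫ ≤ 1` lies in the ball of radius `n`. -/
theorem norm_le (h : IsJohnDecomposition u c) {x : EuclideanSpace ℝ (Fin n)}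
    (hx : ∀ i, inner ℝ (u i) x ≤ 1) : ‖x‖ ≤ n := by
  have h1 : 0 ≤ ∑ i, c i * ((1 - inner ℝ (u i) x) * (‖x‖ + inner ℝ (u i) x)) := by
    refine Finset.sum_nonneg fun i _ => mul_nonneg (h.nonneg i) (mul_nonneg ?_ ?_)
    · linarith [hx i]
    · have := (abs_le.1 (abs_real_inner_le_norm (u i) x)).1
      rw [h.norm_eq_one] at this
      linarith
  have h2 : ∑ i, c i * ((1 - inner ℝ (u i) x) * (‖x‖ + inner ℝ (u i) x)) = n * ‖x‖ - ‖x‖ ^ 2 := by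
    calc _ = (∑ i, c i) * ‖x‖ + (1 - ‖x‖) * (∑ i, c i * inner ℝ (u i) x)
          - ∑ i, c i * inner ℝ (u i) x ^ 2 := by
          rw [Finset.sum_mul, Finset.mul_sum, ← Finset.sum_add_distrib, ← Finset.sum_sub_distrib]
          exact Finset.sum_congr rfl fun i _ => by ring
      _ = _ := by rw [h.sum_weight, h.sum_inner, h.sum_inner_sq]; ring
  rw [h2] at h1
  by_contra! hlt
  nlinarith [norm_nonneg x, Nat.cast_nonneg (α := ℝ) n]

end IsJohnDecomposition

open LinearMap in
theorem abs_det_adjoint {n : ℕ}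
    (A : EuclideanSpace ℝ (Fin n) →ₗ[ℝ] EuclideanSpace ℝ (Fin n)) :
    |LinearMap.det (LinearMap.adjoint A)| = |LinearMap.det A| := by
  let b := EuclideanSpace.basisFun (Fin n) ℝ
  rw [← LinearMap.det_toMatrix b.toBasis, toMatrix_adjoint, Matrix.det_conjTranspose,
    LinearMap.det_toMatrix b.toBasis]
  simp

/-- For unit `v`, `‖T v‖ ≥ ⟪|T| v, v⟫`, written in an orthonormal eigenbasis `f` of `|T|`. -/
theorem exists_sum_singularValues_le {n : ℕ}
    (T : EuclideanSpace ℝ (Fin n) →ₗ[ℝ] EuclideanSpace ℝ (Fin n)) :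
    ∃ (f : OrthonormalBasis (Fin n) ℝ (EuclideanSpace ℝ (Fin n))) (s : Fin n → ℝ),
      (∀ k, 0 ≤ s k) ∧ |LinearMap.det T| = ∏ k, s k ∧
      ∀ v, ‖v‖ = 1 → ∑ k, s k * inner ℝ (f k) v ^ 2 ≤ ‖T v‖ := by
  have hn : Module.finrank ℝ (EuclideanSpace ℝ (Fin n)) = n := by simp
  have hs := T.isPositive_adjoint_comp_self.isSymmetric
  refine ⟨hs.eigenvectorBasis hn, fun k => T.singularValues k,
    fun k => T.singularValues_nonneg k, ?_, fun v hv => ?_⟩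
  · rw [← LinearMap.normDet_eq_abs_det, LinearMap.normDet_eq_prod_singularValues, hn,
      ← Fin.prod_univ_eq_prod_range]
  · set f := hs.eigenvectorBasis hn
    have h1 : ‖T v‖ ^ 2 = ∑ k : Fin n, (T.singularValues k * inner ℝ (f k) v) ^ 2 := by
      rw [← real_inner_self_eq_norm_sq, ← LinearMap.adjoint_inner_left,
        ← f.sum_inner_mul_inner]
      refine Finset.sum_congr rfl fun k _ => ?_
      have h3 : inner ℝ (LinearMap.adjoint T (T v)) (f k)
          = T.singularValues k ^ 2 * inner ℝ (f k) v := by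
        have h4 := hs v (f k)
        have h5 := hs.apply_eigenvectorBasis hn k
        rw [← LinearMap.comp_apply, h4, h5, ← T.sq_singularValues_fin hn k, inner_smul_right,
          real_inner_comm]
        simp [f]
      rw [h3]
      ring
    have h2 : (∑ k : Fin n, T.singularValues k * inner ℝ (f k) v ^ 2) ^ 2 ≤ ‖T v‖ ^ 2 := by
      have := Finset.sum_mul_sq_le_sq_mul_sq Finset.univ (fun k : Fin n => inner ℝ (f k) v)
        (fun k : Fin n => T.singularValues k * inner ℝ (f k) v)
      rw [f.sum_sq_inner_right, hv, ← h1, one_pow, one_mul] at this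
      refine le_of_eq_of_le ?_ this
      congr 1
      exact Finset.sum_congr rfl fun k _ => by ring
    exact le_of_sq_le_sq h2 (norm_nonneg _)

/-- Easy direction of John's theorem: `B ⊆ K` and a John decomposition whose vectors support `K`
at height `1` certify that the unit ball is the John ellipsoid. -/
theorem IsJohnDecomposition.isJohnEllipsoid {n : ℕ} {ι : Type*} [Fintype ι]
    {u : ι → EuclideanSpace ℝ (Fin n)} {c : ι → ℝ} (h : IsJohnDecomposition u c)
    {K : Set (EuclideanSpace ℝ (Fin n))} (hB : Metric.closedBall 0 1 ⊆ K)
    (hK : ∀ x ∈ K, ∀ i, inner ℝ (u i) x ≤ 1) : IsJohnEllipsoid K (Metric.closedBall 0 1) := by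
  refine ⟨⟨0, ContinuousLinearEquiv.refl ℝ _, by simp⟩, hB, ?_⟩
  rintro _ ⟨a, A, rfl⟩ hE
  have hvol : volume ((fun x => a + A x) '' Metric.closedBall 0 1)
      = ENNReal.ofReal |LinearMap.det (A : EuclideanSpace ℝ (Fin n) →ₗ[ℝ] _)|
        * volume (Metric.closedBall (0 : EuclideanSpace ℝ (Fin n)) 1) := by
    rw [← Set.image_image (fun y => a + y) A, Set.image_add_left, measure_preimage_add,
      Measure.addHaar_image_continuousLinearEquiv]
  rw [hvol]
  set T := LinearMap.adjoint (A : EuclideanSpace ℝ (Fin n) →ₗ[ℝ] EuclideanSpace ℝ (Fin n)) with hT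
  obtain ⟨f, s, hs0, hdet, hs⟩ := exists_sum_singularValues_le T
  have hdet' : |LinearMap.det T| ≤ 1 := by
    -- The support function of the ellipsoid at `u i` is `⟪a, u i⟫ + ‖T (u i)‖`.
    have hsupp : ∀ i, inner ℝ (u i) a + ‖T (u i)‖ ≤ 1 := by
      intro i
      rcases eq_or_ne (T (u i)) 0 with h0 | h0
      · rw [h0, norm_zero, add_zero]
        exact hK _ (hE ⟨0, by simp, by simp⟩) i
      · have hmem : a + A (‖T (u i)‖⁻¹ • T (u i)) ∈ K :=
          hE ⟨_, by simp [norm_smul, h0], rfl⟩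
        have h1 := hK _ hmem i
        have h2 : inner ℝ (u i) (A (T (u i))) = ‖T (u i)‖ ^ 2 := by
          rw [← real_inner_self_eq_norm_sq]
          exact (LinearMap.adjoint_inner_left
            (A : EuclideanSpace ℝ (Fin n) →ₗ[ℝ] EuclideanSpace ℝ (Fin n)) _ _).symm
        rw [inner_add_right, map_smul, inner_smul_right, h2] at h1
        have h3 : ‖T (u i)‖⁻¹ * ‖T (u i)‖ ^ 2 = ‖T (u i)‖ := by
          field_simp [norm_ne_zero_iff.2 h0]
        linarith
    have hsum : ∑ k, s k ≤ n := by
      calc ∑ k, s k = ∑ i, c i * ∑ k, s k * inner ℝ (f k) (u i) ^ 2 := by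
            simp_rw [Finset.mul_sum]
            rw [Finset.sum_comm]
            refine Finset.sum_congr rfl fun k _ => ?_
            have := h.sum_inner_sq (f k)
            rw [f.norm_eq_one, one_pow] at this
            calc s k = s k * ∑ i, c i * inner ℝ (u i) (f k) ^ 2 := by rw [this, mul_one]
              _ = _ := by
                rw [Finset.mul_sum]
                refine Finset.sum_congr rfl fun i _ => ?_
                rw [real_inner_comm]; ring
        _ ≤ ∑ i, c i * (1 - inner ℝ (u i) a) := by
            refine Finset.sum_le_sum fun i _ => mul_le_mul_of_nonneg_left ?_ (h.nonneg i)
            linarith [hs (u i) (h.norm_eq_one i), hsupp i]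
        _ = n := by
            simp_rw [mul_sub, mul_one, Finset.sum_sub_distrib]
            rw [h.sum_weight, h.sum_inner, sub_zero]
    rw [hdet]
    calc ∏ k, s k ≤ ∏ k, Real.exp (s k - 1) :=
          Finset.prod_le_prod (fun k _ => hs0 k) fun k _ => by
            linarith [Real.add_one_le_exp (s k - 1)]
      _ = Real.exp (∑ k, s k - n) := by rw [← Real.exp_sum]; simp
      _ ≤ 1 := Real.exp_le_one_iff.2 (by linarith)
  rw [hT, abs_det_adjoint] at hdet'
  calc _ ≤ 1 * volume (Metric.closedBall (0 : EuclideanSpace ℝ (Fin n)) 1) := by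
        gcongr
        exact ENNReal.ofReal_le_one.2 hdet'
    _ = _ := one_mul _

/-! ### Facets of an intersection of half-spaces -/

/-- A facet of a full-dimensional intersection of half-spaces is cut out by one of the bounding
hyperplanes. -/
theorem IsFacet.exists_eq_of_halfSpaces {n : ℕ} {ι : Type*} [Fintype ι]
    {v : ι → EuclideanSpace ℝ (Fin n)} {F : Set (EuclideanSpace ℝ (Fin n))}
    (hF : IsFacet {x | ∀ i, inner ℝ (v i) x ≤ 1} F) :
    ∃ i, F = {x | (∀ j, inner ℝ (v j) x ≤ 1) ∧ inner ℝ (v i) x = 1} := by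
  obtain ⟨hne, hexp, hdim⟩ := hF
  obtain ⟨l, hl⟩ := hexp hne
  set P : Set (EuclideanSpace ℝ (Fin n)) := {x | ∀ i, inner ℝ (v i) x ≤ 1} with hP
  have hFP : ∀ x ∈ F, x ∈ P := fun x hx => by rw [hl] at hx; exact hx.1
  have hmax : ∀ x ∈ F, ∀ y ∈ P, l y ≤ l x := fun x hx => by rw [hl] at hx; exact hx.2
  have hopen : IsOpen {x : EuclideanSpace ℝ (Fin n) | ∀ i, inner ℝ (v i) x < 1} := by
    simp only [Set.ofPred_forall]
    exact isOpen_iInter_of_finite fun i => isOpen_lt (by fun_prop) continuous_const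
  -- A point of the facet off all the hyperplanes would make the exposing functional vanish.
  have hslack : ¬ ∃ x ∈ F, ∀ i, inner ℝ (v i) x < 1 := by
    rintro ⟨x, hxF, hx⟩
    have hloc : IsLocalMax l x := by
      filter_upwards [hopen.mem_nhds hx] with y hy
      exact hmax x hxF y fun i => (hy i).le
    have hl0 : l = 0 := by
      have := hloc.fderiv_eq_zero
      rwa [l.fderiv] at this
    have hFull : F = P := by rw [hl, hl0]; simp
    have hint : (interior F).Nonempty :=
      ⟨x, mem_interior.2 ⟨_, fun y hy => hFull ▸ fun i => (hy i).le, hopen, hx⟩⟩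
    have haff : vectorSpan ℝ F = ⊤ := by
      rw [← direction_affineSpan]
      have := affineSpan_eq_top_of_nonempty_interior
        (hint.mono (interior_mono (subset_convexHull ℝ F)))
      rw [this, AffineSubspace.direction_top]
    rw [haff, finrank_top, finrank_euclideanSpace, Fintype.card_fin] at hdim
    omega
  have hconv : Convex ℝ F := by
    have hPc : Convex ℝ P := by
      rw [hP]; simp only [Set.ofPred_forall]
      exact convex_iInter fun i => convex_halfSpace_le (innerₛₗ ℝ (v i)).isLinear 1
    exact hexp.convex hPc
  -- By averaging, a single constraint is tight on the whole facet.
  have htight : ∃ i, ∀ x ∈ F, inner ℝ (v i) x = 1 := by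
    by_contra! hcon
    choose x hxF hx using hcon
    rcases isEmpty_or_nonempty ι with hι | hι
    · obtain ⟨y, hy⟩ := hne
      exact hslack ⟨y, hy, fun i => isEmptyElim i⟩
    · have hcard : (0 : ℝ) < Fintype.card ι := by exact_mod_cast Fintype.card_pos
      have hw : ∑ _i : ι, (Fintype.card ι : ℝ)⁻¹ = 1 := by
        simp [hcard.ne']
      refine hslack ⟨∑ i, (Fintype.card ι : ℝ)⁻¹ • x i,
        hconv.sum_mem (fun _ _ => by positivity) hw fun i _ => hxF i, fun i => ?_⟩
      rw [inner_sum]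
      calc ∑ j, inner ℝ (v i) ((Fintype.card ι : ℝ)⁻¹ • x j)
          < ∑ _j : ι, (Fintype.card ι : ℝ)⁻¹ := by
            refine Finset.sum_lt_sum (fun j _ => ?_) ⟨i, Finset.mem_univ _, ?_⟩
            · rw [inner_smul_right]
              exact mul_le_of_le_one_right (by positivity) (hFP _ (hxF j) i)
            · rw [inner_smul_right]
              exact mul_lt_of_lt_one_right (by positivity)
                (lt_of_le_of_ne (hFP _ (hxF i) i) (hx i))
        _ = 1 := hw
  obtain ⟨i, hi⟩ := htight
  obtain ⟨z, hz⟩ := hne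
  have hvi : v i ≠ 0 := fun h0 => by
    have := hi z hz
    rw [h0, inner_zero_left] at this
    exact zero_ne_one this
  -- The directions of `F` fill the hyperplane, and the exposing functional kills them.
  have hspan : vectorSpan ℝ F = LinearMap.ker (innerₛₗ ℝ (v i)) := by
    refine Submodule.eq_of_le_of_finrank_eq ?_ ?_
    · rw [vectorSpan, Submodule.span_le]
      rintro _ ⟨x, hx, y, hy, rfl⟩
      simp [inner_sub_right, hi x hx, hi y hy]
    · have hsurj : Function.Surjective (innerₛₗ ℝ (v i)) := by
        apply LinearMap.surjective
        intro h0
        exact hvi (by simpa using LinearMap.congr_fun h0 (v i))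
      have := LinearMap.finrank_range_add_finrank_ker (innerₛₗ ℝ (v i))
      rw [LinearMap.range_eq_top.2 hsurj, finrank_top, finrank_euclideanSpace, Fintype.card_fin,
        Module.finrank_self] at this
      omega
  have hker : ∀ w ∈ vectorSpan ℝ F, l w = 0 := by
    intro w hw
    have : vectorSpan ℝ F ≤ LinearMap.ker (l : EuclideanSpace ℝ (Fin n) →ₗ[ℝ] ℝ) := by
      rw [vectorSpan, Submodule.span_le]
      rintro _ ⟨x, hx, y, hy, rfl⟩
      have := le_antisymm (hmax x hx y (hFP y hy)) (hmax y hy x (hFP x hx))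
      simp [this]
    exact this hw
  refine ⟨i, Set.Subset.antisymm (fun x hx => ⟨hFP x hx, hi x hx⟩) ?_⟩
  rintro x ⟨hxP, hx1⟩
  have hxz : x - z ∈ vectorSpan ℝ F := by
    rw [hspan]
    simp [inner_sub_right, hx1, hi z hz]
  have hlx : l x = l z := by
    have := hker _ hxz
    rwa [map_sub, sub_eq_zero] at this
  rw [hl]
  exact ⟨hxP, fun y hy => hlx ▸ hmax z hz y hy⟩

theorem finite_facets_and_ncard_le {n : ℕ} {ι : Type*} [Fintype ι]
    (v : ι → EuclideanSpace ℝ (Fin n)) :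
    {F | IsFacet {x | ∀ i, inner ℝ (v i) x ≤ 1} F}.Finite ∧
      {F | IsFacet {x | ∀ i, inner ℝ (v i) x ≤ 1} F}.ncard ≤ Fintype.card ι := by
  have hsub : {F | IsFacet {x | ∀ i, inner ℝ (v i) x ≤ 1} F} ⊆
      Set.range fun i => {x | (∀ j, inner ℝ (v j) x ≤ 1) ∧ inner ℝ (v i) x = 1} :=
    fun F hF => (IsFacet.exists_eq_of_halfSpaces hF).imp fun i hi => hi.symm
  refine ⟨(Set.finite_range _).subset hsub, (Set.ncard_le_ncard hsub (Set.finite_range _)).trans ?_⟩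
  rw [← Nat.card_coe_set_eq, ← Nat.card_eq_fintype_card]
  exact Finite.card_range_le _

/-! ### The contact points -/

/-- The sign `1` or `-1` encoded by a Boolean. -/
def boolSign (b : Bool) : ℝ := if b then 1 else -1

theorem forall_boolSign_mul_le_iff {a b : ℝ} : (∀ s, boolSign s * a ≤ b) ↔ |a| ≤ b := by
  simp [boolSign, abs_le', and_comm]

/-- The length of the component of a contact point orthogonal to the axis. -/
noncomputable def contactSlope (m : ℕ) : ℝ := √(1 - (1 / ((m : ℝ) + 1)) ^ 2)

theorem contactSlope_sq (m : ℕ) : contactSlope m ^ 2 = 1 - (1 / ((m : ℝ) + 1)) ^ 2 := by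
  refine Real.sq_sqrt (sub_nonneg.2 (pow_le_one₀ (by positivity) ?_))
  rw [div_le_one (by positivity)]
  linarith [Nat.cast_nonneg (α := ℝ) m]

theorem contactSlope_nonneg (m : ℕ) : 0 ≤ contactSlope m := Real.sqrt_nonneg _

theorem contactSlope_le_one (m : ℕ) : contactSlope m ≤ 1 :=
  Real.sqrt_le_one.2 (by linarith [sq_nonneg (1 / ((m : ℝ) + 1))])

/-- The contact points in `ℝ^(m+1)`: the pole `-e₀`, and for each sign and each `j` the unit
vector `(1/(m+1)) e₀ ± β e_{j+1}`. They are the outer normals of a cone over a cube of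
dimension `m`, whose apex lies at height `m + 1` above the centre of the ball. -/
noncomputable def contactPoint (m : ℕ) :
    Option (Fin m × Bool) → EuclideanSpace ℝ (Fin (m + 1))
  | none => -EuclideanSpace.single 0 1
  | some (j, b) => (1 / ((m : ℝ) + 1)) • EuclideanSpace.single 0 1 +
      (boolSign b * contactSlope m) • EuclideanSpace.single j.succ 1

/-- The weights that turn the contact points into a John decomposition. -/
noncomputable def contactWeight (m : ℕ) : Option (Fin m × Bool) → ℝ
  | none => ((m : ℝ) + 1) / (m + 2)
  | some _ => ((m : ℝ) + 1) ^ 2 / (2 * m * (m + 2))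

theorem inner_contactPoint_none {m : ℕ} (x : EuclideanSpace ℝ (Fin (m + 1))) :
    inner ℝ (contactPoint m none) x = -x 0 := by
  simp [contactPoint, EuclideanSpace.inner_single_left]

theorem inner_contactPoint_some {m : ℕ} (j : Fin m) (b : Bool)
    (x : EuclideanSpace ℝ (Fin (m + 1))) :
    inner ℝ (contactPoint m (some (j, b))) x =
      x 0 / (m + 1) + boolSign b * (contactSlope m * x j.succ) := by
  simp [contactPoint, EuclideanSpace.inner_single_left, inner_add_left, real_inner_smul_left]
  ring

theorem forall_inner_contactPoint_le_one_iff {m : ℕ} {x : EuclideanSpace ℝ (Fin (m + 1))} :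
    (∀ i, inner ℝ (contactPoint m i) x ≤ 1) ↔
      -1 ≤ x 0 ∧ ∀ j : Fin m, contactSlope m * |x j.succ| ≤ 1 - x 0 / (m + 1) := by
  rw [Option.forall, inner_contactPoint_none, Prod.forall]
  refine and_congr ⟨fun h => by linarith, fun h => by linarith⟩ (forall_congr' fun j => ?_)
  rw [show contactSlope m * |x j.succ| = |contactSlope m * x j.succ| by
    rw [abs_mul, abs_of_nonneg (contactSlope_nonneg m)], ← forall_boolSign_mul_le_iff]
  refine forall_congr' fun b => ?_
  rw [inner_contactPoint_some]
  constructor <;> intro h <;> linarith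

theorem EuclideanSpace.norm_sq_eq_head_add_tail {m : ℕ} (x : EuclideanSpace ℝ (Fin (m + 1))) :
    ‖x‖ ^ 2 = x 0 ^ 2 + ∑ j : Fin m, x j.succ ^ 2 := by
  rw [EuclideanSpace.real_norm_sq_eq, Fin.sum_univ_succ]

theorem isJohnDecomposition_contactPoint {m : ℕ} (hm : 0 < m) :
    IsJohnDecomposition (contactPoint m) (contactWeight m) := by
  have hm' : (0 : ℝ) < m := by exact_mod_cast hm
  refine ⟨?_, ?_, ?_, ?_⟩
  · rintro (_ | ⟨j, b⟩) <;> simp only [contactWeight] <;> positivity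
  · rintro (_ | ⟨j, b⟩)
    · simp [contactPoint]
    · have hb : boolSign b ^ 2 = 1 := by cases b <;> simp [boolSign]
      have h : ‖contactPoint m (some (j, b))‖ ^ 2 = 1 := by
        rw [← real_inner_self_eq_norm_sq, inner_contactPoint_some]
        have hj : (j.succ : Fin (m + 1)) ≠ 0 := Fin.succ_ne_zero j
        simp only [contactPoint, PiLp.add_apply, PiLp.smul_apply, PiLp.single_apply,
          hj, hj.symm, if_true, if_false, smul_eq_mul, mul_one, mul_zero, add_zero, zero_add]
        linear_combination contactSlope m ^ 2 * hb + contactSlope_sq m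
      exact (pow_eq_one_iff_of_nonneg (norm_nonneg _) two_ne_zero).1 h
  · refine ext_inner_right ℝ fun x => ?_
    rw [sum_inner, Fintype.sum_option, Fintype.sum_prod_type]
    simp only [real_inner_smul_left, Fintype.sum_bool, inner_contactPoint_none,
      inner_contactPoint_some, contactWeight, boolSign, inner_zero_left]
    rw [Finset.sum_congr rfl fun j _ => show _ = (m + 1 : ℝ) / (m * (m + 2)) * x 0 by
      simp; field_simp; ring]
    simp
    field_simp
    ring
  · intro x
    rw [Fintype.sum_option, Fintype.sum_prod_type, EuclideanSpace.norm_sq_eq_head_add_tail]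
    simp only [Fintype.sum_bool, inner_contactPoint_none, inner_contactPoint_some, contactWeight,
      boolSign]
    rw [Finset.sum_congr rfl fun j _ => show _ = x 0 ^ 2 / (m * (m + 2)) + x j.succ ^ 2 by
      have h := contactSlope_sq m
      simp only [if_true, Bool.false_eq_true, if_false]
      calc _ = (m + 1 : ℝ) ^ 2 / (m * (m + 2)) *
            ((x 0 / (m + 1)) ^ 2 + contactSlope m ^ 2 * x j.succ ^ 2) := by field_simp; ring
        _ = _ := by rw [h]; field_simp; ring]
    rw [Finset.sum_add_distrib]
    simp
    field_simp
    ring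

/-- A closed convex set between the unit ball and the cone over the cube is a convex body
whose John ellipsoid is the unit ball. -/
theorem isConvexBody_and_isJohnEllipsoid {m : ℕ} (hm : 0 < m)
    {K : Set (EuclideanSpace ℝ (Fin (m + 1)))} (hconv : Convex ℝ K) (hclosed : IsClosed K)
    (hB : Metric.closedBall 0 1 ⊆ K) (hK : ∀ x ∈ K, ∀ i, inner ℝ (contactPoint m i) x ≤ 1) :
    IsConvexBody K ∧ Bornology.IsBounded K ∧ IsJohnEllipsoid K (Metric.closedBall 0 1) := by
  have h := isJohnDecomposition_contactPoint hm
  have hb : Bornology.IsBounded K :=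
    (Metric.isBounded_closedBall (x := 0) (r := ((m + 1 : ℕ) : ℝ))).subset fun x hx => by
      simpa using h.norm_le (hK x hx)
  refine ⟨⟨hconv, Metric.isCompact_of_isClosed_isBounded hclosed hb, 0, ?_⟩, hb,
    h.isJohnEllipsoid hB hK⟩
  exact interior_mono (Metric.ball_subset_closedBall.trans hB)
    (by rw [Metric.isOpen_ball.interior_eq]; simp)

theorem isEllipsoidCenteredAt_closedBall {n : ℕ} :
    IsEllipsoidCenteredAt (0 : EuclideanSpace ℝ (Fin n)) (Metric.closedBall 0 1) :=
  ⟨ContinuousLinearEquiv.refl ℝ _, by simp⟩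

theorem inner_contactPoint_le_one_of_mem_closedBall {m : ℕ} (hm : 0 < m)
    {x : EuclideanSpace ℝ (Fin (m + 1))} (hx : x ∈ Metric.closedBall 0 1)
    (i : Option (Fin m × Bool)) : inner ℝ (contactPoint m i) x ≤ 1 := by
  have h1 := real_inner_le_norm (contactPoint m i) x
  rw [(isJohnDecomposition_contactPoint hm).norm_eq_one, one_mul] at h1
  exact h1.trans (by simpa using hx)

theorem coord_le_of_mem_smul_closedBall {n : ℕ} {r : ℝ} (hr : 0 ≤ r)
    {x : EuclideanSpace ℝ (Fin n)} (hx : x ∈ r • Metric.closedBall (0 : EuclideanSpace ℝ (Fin n)) 1)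
    (i : Fin n) : x i ≤ r := by
  obtain ⟨y, hy, rfl⟩ := hx
  have h1 : y i ≤ 1 := (le_abs_self _).trans
    ((PiLp.norm_apply_le y i).trans (by simpa using hy))
  simpa using mul_le_mul_of_nonneg_left h1 hr

/-! ### Volumes of products -/

theorem volume_head_tail {m : ℕ} (I : Set ℝ) (T : Set (Fin m → ℝ)) :
    volume {x : EuclideanSpace ℝ (Fin (m + 1)) | x 0 ∈ I ∧ (fun j : Fin m => x j.succ) ∈ T}
      = volume I * volume T := by
  rw [← Measure.prod_prod, ← Measure.volume_eq_prod]
  have h1 := (volume_preserving_piFinSuccAbove (fun _ : Fin (m + 1) => ℝ) 0).measure_preimage_equiv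
    (I ×ˢ T)
  rw [← (EuclideanSpace.volume_preserving_symm_measurableEquiv_toLp
    (Fin (m + 1))).measure_preimage_equiv] at h1
  rw [← h1]
  rfl

theorem volume_head_tail_euclidean {m : ℕ} (I : Set ℝ) (T : Set (EuclideanSpace ℝ (Fin m))) :
    volume {x : EuclideanSpace ℝ (Fin (m + 1)) |
        x 0 ∈ I ∧ WithLp.toLp 2 (fun j : Fin m => x j.succ) ∈ T} = volume I * volume T := by
  rw [← (EuclideanSpace.volume_preserving_symm_measurableEquiv_toLp
    (Fin m)).symm.measure_preimage_equiv T, ← volume_head_tail]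
  rfl

theorem volume_box {m : ℕ} (a : Fin m → ℝ) :
    volume {y : Fin m → ℝ | ∀ j, |y j| ≤ a j} = ∏ j, ENNReal.ofReal (2 * a j) := by
  have h : {y : Fin m → ℝ | ∀ j, |y j| ≤ a j} = Set.pi Set.univ fun j => Set.Icc (-a j) (a j) := by
    ext y
    simp only [Set.mem_ofPred_eq, Set.mem_univ_pi, Set.mem_Icc, abs_le]
  rw [h, volume_pi_pi]
  refine Finset.prod_congr rfl fun j _ => ?_
  rw [Real.volume_Icc]
  congr 1
  ring

/-! ### A convex body with most of its volume near the apex -/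

/-- A point of the ball of radius `r` with a coordinate exceeding `s` lies in a ball of radius
`√(r² - s²)` about `± s e_j`. If these `2m` balls are small, the cube of half-side `s` contains
half of the ball of radius `r`. -/
theorem volume_closedBall_div_two_le {m : ℕ} {r s : ℝ} (hr : 0 ≤ r) (hs : 0 ≤ s)
    (h : 4 * m * √(r ^ 2 - s ^ 2) ^ m ≤ r ^ m) :
    volume (Metric.closedBall (0 : EuclideanSpace ℝ (Fin m)) r) / 2 ≤
      volume {y : EuclideanSpace ℝ (Fin m) | ‖y‖ ≤ r ∧ ∀ j, |y j| ≤ s} := by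
  set T := {y : EuclideanSpace ℝ (Fin m) | ‖y‖ ≤ r ∧ ∀ j, |y j| ≤ s}
  set C : Fin m × Bool → Set (EuclideanSpace ℝ (Fin m)) := fun p =>
    Metric.closedBall (EuclideanSpace.single p.1 (boolSign p.2 * s)) √(r ^ 2 - s ^ 2)
  have hcover : Metric.closedBall (0 : EuclideanSpace ℝ (Fin m)) r ⊆ T ∪ ⋃ p, C p := by
    intro y hy
    have hyr : ‖y‖ ≤ r := by simpa using hy
    by_cases hT : ∀ j, |y j| ≤ s
    · exact Or.inl ⟨hyr, hT⟩
    · right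
      push Not at hT
      obtain ⟨j, hj⟩ := hT
      obtain ⟨b, hb⟩ : ∃ b, s < boolSign b * y j := by
        by_contra! hcon
        exact hj.not_ge (forall_boolSign_mul_le_iff.1 hcon)
      have hb1 : boolSign b ^ 2 = 1 := by cases b <;> simp [boolSign]
      refine Set.mem_iUnion.2 ⟨(j, b), mem_closedBall_iff_norm.2 (Real.le_sqrt_of_sq_le ?_)⟩
      rw [norm_sub_sq_real, EuclideanSpace.inner_single_right]
      simp only [PiLp.norm_single, norm_mul, Real.norm_eq_abs, mul_pow, sq_abs, hb1,
        conj_trivial]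
      nlinarith [pow_le_pow_left₀ (norm_nonneg y) hyr 2]
  set B := volume (Metric.closedBall (0 : EuclideanSpace ℝ (Fin m)) r) with hBdef
  have hBtop : B ≠ ⊤ := measure_closedBall_lt_top.ne
  set ω := volume (Metric.ball (0 : EuclideanSpace ℝ (Fin m)) 1) with hω
  have hBω : B = ENNReal.ofReal (r ^ m) * ω := by
    rw [hBdef, Measure.addHaar_closedBall _ _ hr, finrank_euclideanSpace, Fintype.card_fin]
  have hCsum : volume (⋃ p, C p) ≤ B / 2 := by
    calc volume (⋃ p, C p) ≤ ∑ p, volume (C p) := measure_iUnion_fintype_le _ _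
      _ = ((2 * m : ℕ) : ENNReal) * (ENNReal.ofReal (√(r ^ 2 - s ^ 2) ^ m) * ω) := by
          simp only [C, Measure.addHaar_closedBall _ _ (Real.sqrt_nonneg _),
            finrank_euclideanSpace, Fintype.card_fin]
          simp [mul_comm]
          rfl
      _ = ENNReal.ofReal (2 * m * √(r ^ 2 - s ^ 2) ^ m) * ω := by
          rw [ENNReal.ofReal_mul (by positivity), ← mul_assoc]
          congr 2
          rw [← ENNReal.ofReal_natCast]
          push_cast; rfl
      _ ≤ ENNReal.ofReal (r ^ m / 2) * ω := by
          gcongr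
          linarith
      _ = B / 2 := by
          rw [hBω, ENNReal.ofReal_div_of_pos two_pos, ENNReal.ofReal_ofNat, ENNReal.div_eq_inv_mul,
            ENNReal.div_eq_inv_mul, mul_assoc]
  have h1 : B ≤ volume T + B / 2 :=
    (measure_mono hcover).trans ((measure_union_le _ _).trans (by gcongr))
  rw [← ENNReal.sub_half hBtop]
  exact tsub_le_iff_right.2 h1

/-- The projection of `ℝ^(m+1)` that forgets the first coordinate. -/
def euclideanTail (m : ℕ) : EuclideanSpace ℝ (Fin (m + 1)) →ₗ[ℝ] EuclideanSpace ℝ (Fin m) where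
  toFun x := WithLp.toLp 2 fun j => x j.succ
  map_add' _ _ := rfl
  map_smul' _ _ := rfl

theorem norm_euclideanTail_le {m : ℕ} (x : EuclideanSpace ℝ (Fin (m + 1))) :
    ‖euclideanTail m x‖ ≤ ‖x‖ := by
  refine le_of_sq_le_sq ?_ (norm_nonneg _)
  rw [EuclideanSpace.norm_sq_eq_head_add_tail x, EuclideanSpace.real_norm_sq_eq]
  exact le_add_of_nonneg_left (sq_nonneg _)

/-- The part of the cone over the cube that lies in the slowly widening round cone
`‖tail x‖ ≤ 2 + x₀ / (m + 1)`. -/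
def roundBody (m : ℕ) : Set (EuclideanSpace ℝ (Fin (m + 1))) :=
  {x | (∀ i, inner ℝ (contactPoint m i) x ≤ 1) ∧ ‖euclideanTail m x‖ ≤ 2 + x 0 / (m + 1)}

theorem convex_roundBody (m : ℕ) : Convex ℝ (roundBody m) := by
  rintro x ⟨hx1, hx2⟩ y ⟨hy1, hy2⟩ a b ha hb hab
  refine ⟨fun i => ?_, ?_⟩
  · rw [inner_add_right, inner_smul_right, inner_smul_right]
    nlinarith [mul_le_mul_of_nonneg_left (hx1 i) ha, mul_le_mul_of_nonneg_left (hy1 i) hb]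
  · rw [map_add, map_smul, map_smul]
    refine (norm_add_le _ _).trans ?_
    rw [norm_smul, norm_smul, Real.norm_of_nonneg ha, Real.norm_of_nonneg hb]
    calc _ ≤ a * (2 + x 0 / (m + 1)) + b * (2 + y 0 / (m + 1)) := by gcongr
      _ = 2 * (a + b) + (a * x 0 + b * y 0) / (m + 1) := by ring
      _ = _ := by rw [hab]; simp

theorem isClosed_roundBody (m : ℕ) : IsClosed (roundBody m) := by
  have hc : Continuous (euclideanTail m) := LinearMap.continuous_of_finiteDimensional _
  refine IsClosed.inter (s₁ := {x | ∀ i, inner ℝ (contactPoint m i) x ≤ 1})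
    (s₂ := {x | ‖euclideanTail m x‖ ≤ 2 + x 0 / (m + 1)}) ?_
    (isClosed_le (by fun_prop) (by fun_prop))
  rw [Set.ofPred_forall]
  exact isClosed_iInter fun i => isClosed_le (by fun_prop) continuous_const

theorem closedBall_subset_roundBody {m : ℕ} (hm : 0 < m) :
    Metric.closedBall 0 1 ⊆ roundBody m := by
  intro x hx
  have hx0 := (forall_inner_contactPoint_le_one_iff.1
    (inner_contactPoint_le_one_of_mem_closedBall hm hx)).1
  refine ⟨inner_contactPoint_le_one_of_mem_closedBall hm hx, ?_⟩
  have h1 : ‖x‖ ≤ 1 := by simpa using hx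
  have h2 : -1 ≤ x 0 / (m + 1) := by
    rw [le_div_iff₀ (by positivity)]
    linarith [Nat.cast_nonneg (α := ℝ) m]
  linarith [norm_euclideanTail_le x]

theorem volume_roundBody_inter_le {m : ℕ} {t : ℝ} (ht : 0 ≤ t) :
    volume ({x | x 0 ≤ t} ∩ roundBody m) ≤
      ENNReal.ofReal (t + 1) * (ENNReal.ofReal ((2 + t / (m + 1)) ^ m) *
        volume (Metric.ball (0 : EuclideanSpace ℝ (Fin m)) 1)) := by
  have hball := Measure.addHaar_closedBall volume (0 : EuclideanSpace ℝ (Fin m))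
    (r := 2 + t / (m + 1)) (by positivity)
  rw [finrank_euclideanSpace, Fintype.card_fin] at hball
  rw [← hball, show t + 1 = t - -1 by ring, ← Real.volume_Icc, ← volume_head_tail_euclidean]
  refine measure_mono ?_
  rintro x ⟨hxt, hx1, hx2⟩
  refine ⟨⟨(forall_inner_contactPoint_le_one_iff.1 hx1).1, hxt⟩, ?_⟩
  rw [mem_closedBall_zero_iff]
  refine hx2.trans ?_
  have : x 0 ≤ t := hxt
  gcongr

theorem le_volume_roundBody {m : ℕ} {t₁ t₂ : ℝ} (ht₁ : 0 ≤ t₁) (ht : t₁ ≤ t₂)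
    (ht₂ : t₂ ≤ m + 1)
    (h : 4 * m * √((2 + t₁ / (m + 1)) ^ 2 - (1 - t₂ / (m + 1)) ^ 2) ^ m ≤
      (2 + t₁ / (m + 1)) ^ m) :
    ENNReal.ofReal (t₂ - t₁) * (ENNReal.ofReal ((2 + t₁ / (m + 1)) ^ m) *
        volume (Metric.ball (0 : EuclideanSpace ℝ (Fin m)) 1) / 2) ≤ volume (roundBody m) := by
  have hball := Measure.addHaar_closedBall volume (0 : EuclideanSpace ℝ (Fin m))
    (r := 2 + t₁ / (m + 1)) (by positivity)
  rw [finrank_euclideanSpace, Fintype.card_fin] at hball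
  have ht₂' : t₂ / (m + 1) ≤ 1 := by rwa [div_le_one (by positivity)]
  have h0 : 0 ≤ t₁ / ((m : ℝ) + 1) := by positivity
  have h0' : 0 ≤ t₂ / ((m : ℝ) + 1) := div_nonneg (ht₁.trans ht) (by positivity)
  rw [← hball]
  refine (mul_le_mul_right (volume_closedBall_div_two_le (s := 1 - t₂ / (m + 1))
    (by positivity) (by linarith) h) _).trans ?_
  rw [← Real.volume_Icc, ← volume_head_tail_euclidean]
  refine measure_mono ?_
  rintro x ⟨⟨hx1, hx2⟩, hxr, hxs⟩
  have hd1 : t₁ / (m + 1) ≤ x 0 / (m + 1) := by gcongr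
  have hd2 : x 0 / (m + 1) ≤ t₂ / (m + 1) := by gcongr
  refine ⟨forall_inner_contactPoint_le_one_iff.2 ⟨by linarith, fun j => ?_⟩,
    hxr.trans (by linarith)⟩
  have := mul_le_of_le_one_left (abs_nonneg (x j.succ)) (contactSlope_le_one m)
  linarith [hxs j]

/-- The numerical comparison behind the round body, with `δ = √(log n / n)`: raising the height
by `9 δ n` multiplies the volume of the sections by at least `(1 + 3δ)^m ≥ 3mδ`, which
outweighs the ratio `δ` of the lengths of the two ranges of heights. -/
theorem roundBody_numerics {m : ℕ} {δ : ℝ} (hm : 3 ≤ m) (hδ : 0 ≤ δ) (hδ1 : 27 * δ ≤ 1)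
    (hlog : δ ^ 2 * (m + 1) = Real.log (m + 1)) (hlog1 : 1 ≤ Real.log (m + 1)) :
    4 * m * √((3 - 18 * δ) ^ 2 - (9 * δ) ^ 2) ^ m ≤ (3 - 18 * δ) ^ m ∧
      4 * (((1 - 27 * δ) * (m + 1) + 1) * (3 - 27 * δ) ^ m) ≤
        9 * δ * (m + 1) * (3 - 18 * δ) ^ m := by
  have hm' : (3 : ℝ) ≤ m := by exact_mod_cast hm
  constructor
  · have hpos : 0 < 3 - 18 * δ := by linarith
    refine le_of_sq_le_sq ?_ (by positivity)
    have hq : 0 ≤ (3 - 18 * δ) ^ 2 - (9 * δ) ^ 2 := by nlinarith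
    have h1 : (3 - 18 * δ) ^ 2 - (9 * δ) ^ 2 ≤ Real.exp (-(9 * δ ^ 2)) * (3 - 18 * δ) ^ 2 := by
      have h2 := Real.add_one_le_exp (-(9 * δ ^ 2))
      calc (3 - 18 * δ) ^ 2 - (9 * δ) ^ 2 ≤ (-(9 * δ ^ 2) + 1) * (3 - 18 * δ) ^ 2 := by
            nlinarith [sq_nonneg δ, mul_nonneg (sq_nonneg δ) (by nlinarith : 0 ≤ 9 - (3 - 18 * δ) ^ 2)]
        _ ≤ _ := by gcongr
    have h3 : Real.exp (-(9 * δ ^ 2)) ^ m ≤ (((m : ℝ) + 1) ^ 4)⁻¹ := by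
      rw [← Real.exp_nat_mul]
      have h4 : (((m : ℝ) + 1) ^ 4)⁻¹ = Real.exp (-(4 * Real.log (m + 1))) := by
        rw [Real.exp_neg, show (4 : ℝ) = ((4 : ℕ) : ℝ) by norm_num, Real.exp_nat_mul,
          Real.exp_log (by positivity)]
      rw [h4, Real.exp_le_exp, ← hlog]
      nlinarith [mul_nonneg (sq_nonneg δ) (by linarith : (0 : ℝ) ≤ 5 * m - 4)]
    calc (4 * m * √((3 - 18 * δ) ^ 2 - (9 * δ) ^ 2) ^ m) ^ 2
        = 16 * m ^ 2 * ((3 - 18 * δ) ^ 2 - (9 * δ) ^ 2) ^ m := by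
          rw [mul_pow, ← pow_mul, mul_comm m 2, pow_mul, Real.sq_sqrt hq]; ring
      _ ≤ 16 * m ^ 2 * (Real.exp (-(9 * δ ^ 2)) * (3 - 18 * δ) ^ 2) ^ m := by gcongr
      _ = 16 * m ^ 2 * Real.exp (-(9 * δ ^ 2)) ^ m * ((3 - 18 * δ) ^ m) ^ 2 := by
          rw [mul_pow, ← pow_mul, ← pow_mul, mul_comm 2 m]; ring
      _ ≤ 16 * m ^ 2 * (((m : ℝ) + 1) ^ 4)⁻¹ * ((3 - 18 * δ) ^ m) ^ 2 := by gcongr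
      _ ≤ 1 * ((3 - 18 * δ) ^ m) ^ 2 := by
          gcongr
          rw [← div_eq_mul_inv, div_le_one (by positivity)]
          calc 16 * (m : ℝ) ^ 2 ≤ ((m : ℝ) + 1) ^ 2 * ((m : ℝ) + 1) ^ 2 := by
                gcongr
                · nlinarith
                · linarith
            _ = ((m : ℝ) + 1) ^ 4 := by ring
      _ = _ := one_mul _
  · have hpos : 0 ≤ 3 - 27 * δ := by linarith
    have h1 : (1 + m * (3 * δ)) * (3 - 27 * δ) ^ m ≤ (3 - 18 * δ) ^ m := by
      calc (1 + m * (3 * δ)) * (3 - 27 * δ) ^ m ≤ (1 + 3 * δ) ^ m * (3 - 27 * δ) ^ m := by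
            gcongr
            exact one_add_mul_le_pow (by linarith) m
        _ = ((1 + 3 * δ) * (3 - 27 * δ)) ^ m := (mul_pow _ _ _).symm
        _ ≤ _ := by
            have : 0 ≤ (1 + 3 * δ) * (3 - 27 * δ) := by positivity
            gcongr
            nlinarith [sq_nonneg δ]
    have h2 : 8 ≤ 9 * δ * (1 + m * (3 * δ)) := by
      nlinarith [mul_nonneg (sq_nonneg δ) (by linarith : (0 : ℝ) ≤ m - 3)]
    calc 4 * (((1 - 27 * δ) * (m + 1) + 1) * (3 - 27 * δ) ^ m)
        ≤ 4 * ((2 * (m + 1)) * (3 - 27 * δ) ^ m) := by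
          gcongr
          nlinarith [mul_nonneg hδ (by linarith : (0 : ℝ) ≤ m + 1)]
      _ = (m + 1) * (8 * (3 - 27 * δ) ^ m) := by ring
      _ ≤ (m + 1) * (9 * δ * (1 + m * (3 * δ)) * (3 - 27 * δ) ^ m) := by gcongr
      _ = 9 * δ * (m + 1) * ((1 + m * (3 * δ)) * (3 - 27 * δ) ^ m) := by ring
      _ ≤ _ := by gcongr

theorem exists_convexBody_volume_near_apex {m : ℕ} (hm : 3 ≤ m)
    (hlog1 : 1 ≤ Real.log ((m + 1 : ℕ) : ℝ))
    (hδ1 : 27 * √(Real.log ((m + 1 : ℕ) : ℝ) / ((m + 1 : ℕ) : ℝ)) ≤ 1) :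
    ∃ K B : Set (EuclideanSpace ℝ (Fin (m + 1))),
      IsConvexBody K ∧ IsJohnEllipsoid K B ∧ IsEllipsoidCenteredAt 0 B ∧
      volume ((((1 - 27 * √(Real.log ((m + 1 : ℕ) : ℝ) / ((m + 1 : ℕ) : ℝ))) *
        ((m + 1 : ℕ) : ℝ)) • B) ∩ K) ≤ volume K / 2 := by
  have hm0 : 0 < m := by omega
  set δ := √(Real.log ((m + 1 : ℕ) : ℝ) / ((m + 1 : ℕ) : ℝ)) with hδdef
  have hδ : 0 ≤ δ := Real.sqrt_nonneg _
  have hN : (0 : ℝ) < (m : ℝ) + 1 := by positivity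
  push_cast at hlog1 hδdef ⊢
  have hlog : δ ^ 2 * (m + 1) = Real.log (m + 1) := by
    rw [hδdef, Real.sq_sqrt (div_nonneg (by linarith) hN.le), div_mul_cancel₀ _ hN.ne']
  obtain ⟨hnum1, hnum2⟩ := roundBody_numerics hm hδ hδ1 hlog hlog1
  obtain ⟨hK, -, hJ⟩ := isConvexBody_and_isJohnEllipsoid hm0 (convex_roundBody m)
    (isClosed_roundBody m) (closedBall_subset_roundBody hm0) fun x hx => hx.1
  refine ⟨roundBody m, Metric.closedBall 0 1, hK, hJ, isEllipsoidCenteredAt_closedBall, ?_⟩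
  set ω := volume (Metric.ball (0 : EuclideanSpace ℝ (Fin m)) 1)
  have ht0 : 0 ≤ (1 - 27 * δ) * (m + 1) := mul_nonneg (by linarith) hN.le
  have hd : ∀ a : ℝ, 2 + (1 - a) * (m + 1) / (m + 1) = 3 - a := fun a => by field_simp; ring
  have hd' : ∀ a : ℝ, 1 - (1 - a) * (m + 1) / (m + 1) = a := fun a => by field_simp; ring
  have hup := volume_roundBody_inter_le (m := m) ht0
  have hlow := le_volume_roundBody (m := m) (t₁ := (1 - 18 * δ) * (m + 1))
    (t₂ := (1 - 9 * δ) * (m + 1)) (mul_nonneg (by linarith) hN.le)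
    (by gcongr; norm_num) (mul_le_of_le_one_left hN.le (by linarith))
    (by rw [hd, hd']; exact hnum1)
  rw [hd] at hup hlow
  calc _ ≤ volume ({x | x 0 ≤ (1 - 27 * δ) * (m + 1)} ∩ roundBody m) :=
        measure_mono (Set.inter_subset_inter_left _ fun x hx =>
          coord_le_of_mem_smul_closedBall ht0 hx 0)
    _ ≤ ENNReal.ofReal (((1 - 27 * δ) * (m + 1) + 1) * (3 - 27 * δ) ^ m) * ω := by
        rw [ENNReal.ofReal_mul (by positivity), mul_assoc]
        exact hup
    _ ≤ ENNReal.ofReal (9 * δ * (m + 1) * (3 - 18 * δ) ^ m / 2 / 2) * ω := by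
        gcongr
        linarith
    _ = ENNReal.ofReal ((1 - 9 * δ) * (m + 1) - (1 - 18 * δ) * (m + 1)) *
          (ENNReal.ofReal ((3 - 18 * δ) ^ m) * ω / 2) / 2 := by
        rw [ENNReal.ofReal_div_of_pos two_pos, ENNReal.ofReal_div_of_pos two_pos,
          ENNReal.ofReal_mul (by positivity), ENNReal.ofReal_ofNat,
          show (1 - 9 * δ) * (m + 1) - (1 - 18 * δ) * (m + 1) = 9 * δ * (m + 1) by ring]
        simp only [div_eq_mul_inv]
        ring
    _ ≤ volume (roundBody m) / 2 := by gcongr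

/-! ### A polytope with quadratically many facets -/

/-- The normals of the polytope: the contact points, and for each pair of distinct tail
coordinates `i`, `j` and each pair of signs a normal whose half-space of height `1` is
`± x_{i+1} ± x_{j+1} ≤ 3/2 + x₀ / (m + 1)`. -/
noncomputable def pairNormal (m : ℕ) :
    Option (Fin m × Bool) ⊕ ({p : Fin m × Fin m // p.1 ≠ p.2} × Bool × Bool) →
      EuclideanSpace ℝ (Fin (m + 1))
  | .inl i => contactPoint m i
  | .inr (p, s, t) => (2 / 3 : ℝ) • (boolSign s • EuclideanSpace.single p.1.1.succ 1 +
      boolSign t • EuclideanSpace.single p.1.2.succ 1 -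
      (1 / ((m : ℝ) + 1)) • EuclideanSpace.single 0 1)

/-- The part of the cone over the cube where any two tail coordinates satisfy
`|x_{i+1}| + |x_{j+1}| ≤ 3/2 + x₀ / (m + 1)`. -/
def pairPolytope (m : ℕ) : Set (EuclideanSpace ℝ (Fin (m + 1))) :=
  {x | ∀ i, inner ℝ (pairNormal m i) x ≤ 1}

theorem inner_pairNormal_inr {m : ℕ} (p : {p : Fin m × Fin m // p.1 ≠ p.2}) (s t : Bool)
    (x : EuclideanSpace ℝ (Fin (m + 1))) :
    inner ℝ (pairNormal m (.inr (p, s, t))) x = 2 / 3 * (boolSign s * x p.1.1.succ +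
      boolSign t * x p.1.2.succ - x 0 / (m + 1)) := by
  simp only [pairNormal, real_inner_smul_left, inner_sub_left, inner_add_left,
    EuclideanSpace.inner_single_left, map_one, one_mul]
  ring

theorem mem_pairPolytope_iff {m : ℕ} {x : EuclideanSpace ℝ (Fin (m + 1))} :
    x ∈ pairPolytope m ↔ (-1 ≤ x 0 ∧
      ∀ j : Fin m, contactSlope m * |x j.succ| ≤ 1 - x 0 / (m + 1)) ∧
      ∀ i j : Fin m, i ≠ j → |x i.succ| + |x j.succ| ≤ 3 / 2 + x 0 / (m + 1) := by
  rw [← forall_inner_contactPoint_le_one_iff]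
  refine Sum.forall.trans (and_congr Iff.rfl ?_)
  constructor
  · intro h i j hij
    obtain ⟨s, hs⟩ : ∃ s, boolSign s * x i.succ = |x i.succ| := by
      rcases abs_choice (x i.succ) with h | h
      · exact ⟨true, by simp [boolSign, h]⟩
      · exact ⟨false, by simp [boolSign, h]⟩
    obtain ⟨t, ht⟩ : ∃ t, boolSign t * x j.succ = |x j.succ| := by
      rcases abs_choice (x j.succ) with h | h
      · exact ⟨true, by simp [boolSign, h]⟩
      · exact ⟨false, by simp [boolSign, h]⟩
    have := h (⟨(i, j), hij⟩, s, t)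
    rw [inner_pairNormal_inr] at this
    dsimp only at this
    rw [hs, ht] at this
    linarith
  · rintro h ⟨⟨⟨i, j⟩, hij⟩, s, t⟩
    rw [inner_pairNormal_inr]
    have h1 := (forall_boolSign_mul_le_iff (a := x i.succ)).2 le_rfl s
    have h2 := (forall_boolSign_mul_le_iff (a := x j.succ)).2 le_rfl t
    have := h i j hij
    dsimp only
    linarith

theorem closedBall_subset_pairPolytope {m : ℕ} (hm : 19 ≤ m) :
    Metric.closedBall 0 1 ⊆ pairPolytope m := by
  intro x hx
  have hm0 : 0 < m := by omega
  have hx0 := forall_inner_contactPoint_le_one_iff.1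
    (inner_contactPoint_le_one_of_mem_closedBall hm0 hx)
  refine mem_pairPolytope_iff.2 ⟨hx0, fun i j hij => ?_⟩
  have h1 : ‖x‖ ^ 2 ≤ 1 := pow_le_one₀ (norm_nonneg x) (by simpa using hx)
  have hpair : x i.succ ^ 2 + x j.succ ^ 2 ≤ ∑ k : Fin m, x k.succ ^ 2 := by
    rw [← Finset.sum_pair hij (f := fun k => x (Fin.succ k) ^ 2)]
    exact Finset.sum_le_sum_of_subset_of_nonneg (Finset.subset_univ _) fun _ _ _ => sq_nonneg _
  rw [EuclideanSpace.norm_sq_eq_head_add_tail] at h1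
  have hsum : |x i.succ| + |x j.succ| ≤ 142 / 100 := by
    refine abs_le_of_sq_le_sq' ?_ (by norm_num) |>.2
    nlinarith [sq_abs (x i.succ), sq_abs (x j.succ), sq_nonneg (|x i.succ| - |x j.succ|),
      sq_nonneg (x 0)]
  have h2 : -(1 / 20) ≤ x 0 / (m + 1) := by
    rw [le_div_iff₀ (by positivity)]
    have : (19 : ℝ) ≤ m := by exact_mod_cast hm
    linarith [hx0.1]
  linarith

theorem convex_pairPolytope (m : ℕ) : Convex ℝ (pairPolytope m) := by
  simp only [pairPolytope, Set.ofPred_forall]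
  exact convex_iInter fun i => convex_halfSpace_le (innerₛₗ ℝ (pairNormal m i)).isLinear 1

theorem isClosed_pairPolytope (m : ℕ) : IsClosed (pairPolytope m) := by
  simp only [pairPolytope, Set.ofPred_forall]
  exact isClosed_iInter fun i => isClosed_le (by fun_prop) continuous_const

theorem card_pairNormal_index_le (m : ℕ) :
    Fintype.card (Option (Fin m × Bool) ⊕ ({p : Fin m × Fin m // p.1 ≠ p.2} × Bool × Bool)) ≤
      4 * (m + 1) ^ 2 := by
  have h := Fintype.card_subtype_le fun p : Fin m × Fin m => p.1 ≠ p.2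
  simp only [Fintype.card_prod, Fintype.card_fin] at h
  simp only [Fintype.card_sum, Fintype.card_option, Fintype.card_prod, Fintype.card_fin,
    Fintype.card_bool]
  nlinarith

/-- In a section of the polytope all coordinates but the largest are at most half of the bound
for pairs, so the section is covered by `m` boxes. -/
theorem volume_pairPolytope_inter_le {m : ℕ} (hm : 2 ≤ m) {t : ℝ} (ht : -1 ≤ t) :
    volume ({x | x 0 ≤ t} ∩ pairPolytope m) ≤
      ENNReal.ofReal ((t + 1) * (m * (2 * (3 / 2 + t / (m + 1)) ^ m))) := by
  set q := 3 / 2 + t / (m + 1) with hq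
  have hq0 : 0 ≤ q := by
    have : -1 ≤ t / (m + 1) := by
      rw [le_div_iff₀ (by positivity)]
      linarith [Nat.cast_nonneg (α := ℝ) m]
    linarith
  have hcover : {x | x 0 ≤ t} ∩ pairPolytope m ⊆ ⋃ k : Fin m,
      {x : EuclideanSpace ℝ (Fin (m + 1)) | x 0 ∈ Set.Icc (-1) t ∧
        (fun j : Fin m => x j.succ) ∈
          {y : Fin m → ℝ | ∀ j, |y j| ≤ Function.update (fun _ => q / 2) k q j}} := by
    rintro x ⟨hxt, hxP⟩
    obtain ⟨⟨hx0, -⟩, hpair⟩ := mem_pairPolytope_iff.1 hxP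
    have hxq : 3 / 2 + x 0 / (m + 1) ≤ q := by
      have : x 0 ≤ t := hxt
      rw [hq]; gcongr
    have : Nonempty (Fin m) := ⟨⟨0, by omega⟩⟩
    obtain ⟨k, -, hk⟩ := Finset.exists_max_image Finset.univ (fun j : Fin m => |x j.succ|)
      Finset.univ_nonempty
    refine Set.mem_iUnion.2 ⟨k, ⟨hx0, hxt⟩, fun j => ?_⟩
    rcases eq_or_ne j k with rfl | hjk
    · have : Nontrivial (Fin m) := Fin.nontrivial_iff_two_le.2 hm
      obtain ⟨i, hi⟩ := exists_ne j
      rw [Function.update_self]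
      linarith [hpair i j hi, abs_nonneg (x i.succ)]
    · rw [Function.update_of_ne hjk]
      linarith [hpair j k hjk, hk j (Finset.mem_univ j)]
  refine (measure_mono hcover).trans ((measure_iUnion_fintype_le _ _).trans_eq ?_)
  have hbox : ∀ k : Fin m, ∏ j, ENNReal.ofReal (2 * Function.update (fun _ => q / 2) k q j)
      = ENNReal.ofReal (2 * q ^ m) := by
    intro k
    rw [← ENNReal.ofReal_prod_of_nonneg, ← Finset.mul_prod_erase _ _ (Finset.mem_univ k),
      Finset.prod_congr rfl fun j hj => by
        rw [Function.update_of_ne (Finset.ne_of_mem_erase hj), mul_div_cancel₀ _ two_ne_zero]]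
    · rw [Function.update_self, Finset.prod_const, Finset.card_erase_of_mem (Finset.mem_univ k),
        Finset.card_univ, Fintype.card_fin, mul_assoc, ← pow_succ', Nat.sub_add_cancel (by omega)]
    · intro j _
      rcases eq_or_ne j k with rfl | hjk
      · rw [Function.update_self]; positivity
      · rw [Function.update_of_ne hjk]; positivity
  simp only [volume_head_tail, volume_box, hbox, Real.volume_Icc, Finset.sum_const,
    Finset.card_univ, Fintype.card_fin, nsmul_eq_mul]
  rw [sub_neg_eq_add, ENNReal.ofReal_mul (show 0 ≤ t + 1 by linarith),
    ENNReal.ofReal_mul (Nat.cast_nonneg m), ENNReal.ofReal_natCast]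
  ring

/-- For heights between `(m+1)/8` and `(m+1)/6` the sections of the polytope contain a cube of
side `13/8`. -/
theorem le_volume_pairPolytope (m : ℕ) :
    ENNReal.ofReal (((m : ℝ) + 1) / 24 * (13 / 8) ^ m) ≤ volume (pairPolytope m) := by
  have hN : (0 : ℝ) < (m : ℝ) + 1 := by positivity
  have h := volume_head_tail (Set.Icc (((m : ℝ) + 1) / 8) ((m + 1) / 6))
    {y : Fin m → ℝ | ∀ j, |y j| ≤ 13 / 16}
  rw [volume_box fun _ : Fin m => (13 / 16 : ℝ), Real.volume_Icc, Finset.prod_const,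
    Finset.card_univ, Fintype.card_fin, ← ENNReal.ofReal_pow (by norm_num),
    ← ENNReal.ofReal_mul (by linarith)] at h
  have h' : ((m : ℝ) + 1) / 24 * (13 / 8) ^ m =
      ((m + 1) / 6 - (m + 1) / 8) * (2 * (13 / 16)) ^ m := by
    norm_num; ring
  rw [h', ← h]
  refine measure_mono ?_
  rintro x ⟨⟨hx1, hx2⟩, hy⟩
  have hd1 : 1 / 8 ≤ x 0 / (m + 1) := by rw [le_div_iff₀ hN]; linarith
  have hd2 : x 0 / (m + 1) ≤ 1 / 6 := by rw [div_le_iff₀ hN]; linarith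
  refine mem_pairPolytope_iff.2 ⟨⟨by linarith, fun j => ?_⟩, fun i j _ => ?_⟩
  · have := mul_le_of_le_one_left (abs_nonneg (x j.succ)) (contactSlope_le_one m)
    linarith [hy j]
  · linarith [hy i, hy j]

/-- The base `26/25` is the ratio of the pair bounds `13/8` at height `n / 8` and `25/16` at height
`n / 16`. -/
theorem exists_polytope_volume_far {m : ℕ} (hm : 19 ≤ m)
    (hlog1 : 1 ≤ Real.log ((m + 1 : ℕ) : ℝ)) (hgrow : 96 * (m : ℝ) ≤ (26 / 25) ^ m) :
    ∃ P B : Set (EuclideanSpace ℝ (Fin (m + 1))),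
      IsConvexBody P ∧ IsPolytope P ∧
      {F | IsFacet P F}.Finite ∧
      ({F | IsFacet P F}.ncard : ℝ) ≤ 4 * ((m + 1 : ℕ) : ℝ) ^ 2 ∧
      IsJohnEllipsoid P B ∧ IsEllipsoidCenteredAt 0 B ∧
      volume (((1 / 16 * (((m + 1 : ℕ) : ℝ) / Real.log ((m + 1 : ℕ) : ℝ))) • B) ∩ P) ≤
        volume P / 2 := by
  classical
  obtain ⟨hP, hbdd, hJ⟩ := isConvexBody_and_isJohnEllipsoid (by omega) (convex_pairPolytope m)
    (isClosed_pairPolytope m) (closedBall_subset_pairPolytope hm) fun x hx i => hx (.inl i)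
  obtain ⟨hfin, hcard⟩ := finite_facets_and_ncard_le (pairNormal m)
  refine ⟨pairPolytope m, Metric.closedBall 0 1, hP,
    ⟨hbdd, Finset.univ.image fun i => (pairNormal m i, 1), ?_⟩, hfin, ?_, hJ,
    isEllipsoidCenteredAt_closedBall, ?_⟩
  · ext x
    refine ⟨fun hx p hp => ?_, fun hx i => hx _ (Finset.mem_image_of_mem _ (Finset.mem_univ i))⟩
    obtain ⟨i, -, rfl⟩ := Finset.mem_image.1 hp
    exact hx i
  · exact_mod_cast hcard.trans (card_pairNormal_index_le m)
  push_cast at hlog1 ⊢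
  have hN : (0 : ℝ) < (m : ℝ) + 1 := by positivity
  have hm' : (19 : ℝ) ≤ m := by exact_mod_cast hm
  have hr : 1 / 16 * (((m : ℝ) + 1) / Real.log (m + 1)) ≤ (m + 1) / 16 := by
    have := div_le_self hN.le hlog1
    linarith
  have hup := volume_pairPolytope_inter_le (m := m) (t := (m + 1) / 16) (by omega) (by linarith)
  rw [show (3 : ℝ) / 2 + (m + 1) / 16 / (m + 1) = 25 / 16 by field_simp; norm_num] at hup
  have hnum : ((m : ℝ) + 1) / 16 + 1 ≤ m + 1 := by linarith
  calc _ ≤ volume ({x | x 0 ≤ ((m : ℝ) + 1) / 16} ∩ pairPolytope m) :=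
        measure_mono (Set.inter_subset_inter_left _ fun x hx =>
          (coord_le_of_mem_smul_closedBall (by positivity) hx 0).trans hr)
    _ ≤ _ := hup
    _ ≤ ENNReal.ofReal (((m : ℝ) + 1) / 24 * (13 / 8) ^ m / 2) := by
        refine ENNReal.ofReal_le_ofReal ?_
        calc (((m : ℝ) + 1) / 16 + 1) * (m * (2 * (25 / 16) ^ m))
            ≤ (m + 1) * (m * (2 * (25 / 16) ^ m)) := by gcongr
          _ = (m + 1) / 48 * ((96 * m) * (25 / 16) ^ m) := by ring
          _ ≤ (m + 1) / 48 * ((26 / 25) ^ m * (25 / 16) ^ m) := by gcongr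
          _ = (m + 1) / 24 * (13 / 8) ^ m / 2 := by
            rw [← mul_pow]; norm_num; ring
    _ ≤ volume (pairPolytope m) / 2 := by
        rw [ENNReal.ofReal_div_of_pos two_pos, ENNReal.ofReal_ofNat]
        gcongr
        exact le_volume_pairPolytope m

/-! ### The asymptotic statement -/

theorem corollary1 :
    (∃ C₀ : ℝ, 0 < C₀ ∧ ∀ᶠ n : ℕ in atTop,
      ∃ K B : Set (EuclideanSpace ℝ (Fin n)),
        IsConvexBody K ∧ IsJohnEllipsoid K B ∧ IsEllipsoidCenteredAt 0 B ∧
        volume ((((1 - C₀ * √(Real.log n / n)) * n) • B) ∩ K) ≤ volume K / 2) ∧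
    (∃ C₁ C₂ : ℝ, 0 < C₁ ∧ 0 < C₂ ∧ ∀ᶠ n : ℕ in atTop,
      ∃ P B : Set (EuclideanSpace ℝ (Fin n)),
        IsConvexBody P ∧ IsPolytope P ∧
        {F | IsFacet P F}.Finite ∧ ({F | IsFacet P F}.ncard : ℝ) ≤ C₂ * (n : ℝ) ^ 2 ∧
        IsJohnEllipsoid P B ∧ IsEllipsoidCenteredAt 0 B ∧
        volume (((C₁ * (n / Real.log n)) • B) ∩ P) ≤ volume P / 2) := by
  have hlog : ∀ᶠ n : ℕ in atTop, 1 ≤ Real.log n :=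
    (Real.tendsto_log_atTop.comp tendsto_natCast_atTop_atTop).eventually_ge_atTop 1
  refine ⟨⟨27, by norm_num, ?_⟩, ⟨1 / 16, 4, by norm_num, by norm_num, ?_⟩⟩
  · have hδ : Tendsto (fun n : ℕ => 27 * √(Real.log n / n)) atTop (nhds 0) := by
      have h1 : Tendsto (fun x : ℝ => Real.log x / x) atTop (nhds 0) :=
        Real.isLittleO_log_id_atTop.tendsto_div_nhds_zero
      have h2 := ((h1.comp tendsto_natCast_atTop_atTop).sqrt).const_mul (27 : ℝ)
      simpa [Function.comp_def] using h2
    filter_upwards [hlog, hδ.eventually_le_const zero_lt_one, eventually_ge_atTop 4]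
      with n hn1 hn2 hn3
    obtain ⟨m, rfl⟩ : ∃ m, n = m + 1 := ⟨n - 1, by omega⟩
    exact exists_convexBody_volume_near_apex (by omega) hn1 hn2
  · have hgrow : ∀ᶠ m : ℕ in atTop, 96 * (m : ℝ) ≤ (26 / 25) ^ m := by
      have h := tendsto_pow_const_div_const_pow_of_one_lt 1 (r := (26 / 25 : ℝ)) (by norm_num)
      filter_upwards [h.eventually_le_const (show (0 : ℝ) < 1 / 96 by norm_num)] with m hm
      rw [pow_one, div_le_iff₀ (by positivity)] at hm
      linarith
    filter_upwards [hlog, (tendsto_sub_atTop_nat 1).eventually hgrow, eventually_ge_atTop 20]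
      with n hn1 hn2 hn3
    obtain ⟨m, rfl⟩ : ∃ m, n = m + 1 := ⟨n - 1, by omega⟩
    exact exists_polytope_volume_far (by omega) hn1 (by simpa using hn2)
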